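/- Let $n\ge 1$ and let $A=A_1\oplus\cdots\oplus A_n$ be a unital C*-algebra such that each $A_i$ is nonzero and has no central projections other than $0$ and its unit. Let $G$ be a discrete group and let $(\alpha,\omega)$ be a twisted action of $G$ on $A$: maps $\alpha:G\to\operatorname{Aut}(A)$ and $\omega:G\times G\to U(A)$ with $\alpha_s\alpha_t=\operatorname{Ad}(\omega(s,t))\,\alpha_{st}$, $\omega(r,s)\omega(rs,t)=\alpha_r(\omega(s,t))\,\omega(r,st)$ and $\omega(e,t)=\omega(t,e)=1$. For each $i$ let $p_i\in A$ be the unit of the summand $A_i$. Then $p_1,\dots,p_n$ are exactly the minimal central projections of $A$, and $g\cdot p_i:=\alpha_g(p_i)$ defines a true action of $G$ on $\{p_1,\dots,p_n\}$. Let $H\le G$ be the stabilizer of $p_1$. If $G$ acts transitively on $\{p_1,\dots,p_n\}$, then $$A\rtimes_{\alpha,\omega}G\;\cong\;M_n\otimes\bigl(A_1\rtimes_{\tilde\alpha,\tilde\omega}H\bigr)$$ as C*-algebras, where $(\tilde\alpha,\tilde\omega)$ is the twisted action restricted to $H$ and $A_1$, that is, $\tilde\alpha_t(a)=\alpha_t(p_1a)$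 and $\tilde\omega(s,t)=p_1\omega(s,t)$ for $s,t\in H$, $a\in A_1$, and $M_n\otimes B=M_n(B)$. Here $B\rtimes_{\beta,\sigma}\Gamma$ is the reduced twisted crossed product: for a faithful unital $*$-representation $\pi$ of $B$ on a Hilbert space $K$, it is the C*-algebra of operators on $\ell^2(\Gamma,K)$ generated by the operators $(b\,\xi)(h)=\pi(\beta_{h^{-1}}(b))\,\xi(h)$, $b\in B$, and $(u_g\xi)(h)=\pi(\sigma(h^{-1},g))\,\xi(g^{-1}h)$, $g\in\Gamma$. The isomorphism holds for every choice of faithful unital representations of $A$ and of $A_1$ used to form the two crossed products. -/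

import Mathlib

noncomputable section

open scoped ENNReal

/-- A twisted action `(α, ω)` of a discrete group `G` on a unital C⋆-algebra `A`: automorphisms
`α g` of `A` and unitaries `ω s t` of `A` with `α s ∘ α t = Ad (ω s t) ∘ α (s * t)`, the 2-cocycle
identity, and the normalisation `ω 1 t = ω t 1 = 1` (which forces `α 1 = id`). -/
structure TwistedAction (G : Type*) [Group G] (A : Type*) [CStarAlgebra A] where
  α : G → (A ≃⋆ₐ[ℂ] A)
  ω : G → G → unitary A
  α_comp : ∀ (s t : G) (a : A),
    α s (α t a) = (ω s t : A) * α (s * t) a * star (ω s t : A)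
  cocycle : ∀ r s t : G,
    (ω r s : A) * (ω (r * s) t : A) = α r (ω s t : A) * (ω r (s * t) : A)
  ω_one_left : ∀ t : G, ω 1 t = 1
  ω_one_right : ∀ t : G, ω t 1 = 1

namespace TwistedAction

section Reduced

/-! ### The reduced twisted crossed product -/

variable {G : Type*} [Group G] {A : Type*} [CStarAlgebra A] (T : TwistedAction G A)
  {K : Type*} [NormedAddCommGroup K] [InnerProductSpace ℂ K] [CompleteSpace K]
  (π : A →⋆ₐ[ℂ] (K →L[ℂ] K))

/-- The Hilbert space `ℓ²(G, K)`. -/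
abbrev l2 (G K : Type*) [NormedAddCommGroup K] : Type _ := lp (fun _ : G => K) 2

theorem memLp_weighted {C : ℝ} (S : G → K →L[ℂ] K) (hS : ∀ h, ‖S h‖ ≤ C)
    (σ : Equiv.Perm G) (ξ : l2 G K) :
    Memℓp (fun h => S h (ξ (σ h))) 2 := by
  have hξ := (lp.memℓp ξ).summable (by norm_num)
  refine memℓp_gen ?_
  have h1 : Summable fun h => C ^ 2 * ‖ξ (σ h)‖ ^ 2 := by
    have := (σ.summable_iff (f := fun h => ‖ξ h‖ ^ 2)).2 (by simpa using hξ)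
    exact this.mul_left _
  refine Summable.of_nonneg_of_le (fun _ => by positivity) (fun h => ?_) h1
  have : ‖S h (ξ (σ h))‖ ≤ C * ‖ξ (σ h)‖ := (S h).le_of_opNorm_le (hS h) _
  simpa [mul_pow] using pow_le_pow_left₀ (norm_nonneg _) this 2

/-- For a bounded family `S h` of operators on `K` and a permutation `σ` of `G`, the bounded
operator on `ℓ²(G, K)` given by `ξ ↦ (h ↦ S h (ξ (σ h)))`. -/
def weighted (C : ℝ) (S : G → K →L[ℂ] K) (hS : ∀ h, ‖S h‖ ≤ C) (σ : Equiv.Perm G) :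
    l2 G K →L[ℂ] l2 G K :=
  LinearMap.mkContinuous
    { toFun := fun ξ => ⟨fun h => S h (ξ (σ h)), memLp_weighted S hS σ ξ⟩
      map_add' := fun ξ η => by ext h; simp; rfl
      map_smul' := fun c ξ => by ext h; simp }
    C (fun ξ => by
      have hC : 0 ≤ C := (norm_nonneg _).trans (hS 1)
      have h2 : (0 : ℝ) < (2 : ℝ≥0∞).toReal := by norm_num
      refine lp.norm_le_of_forall_sum_le h2 (by positivity) (fun s => ?_)
      have key : ∀ h, ‖S h (ξ (σ h))‖ ^ 2 ≤ C ^ 2 * ‖ξ (σ h)‖ ^ 2 := fun h => by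
        have : ‖S h (ξ (σ h))‖ ≤ C * ‖ξ (σ h)‖ := (S h).le_of_opNorm_le (hS h) _
        simpa [mul_pow] using pow_le_pow_left₀ (norm_nonneg _) this 2
      have hs := lp.sum_rpow_le_norm_rpow h2 ξ (s.map σ.toEmbedding)
      simp only [Finset.sum_map, Equiv.coe_toEmbedding, ENNReal.toReal_ofNat,
        Real.rpow_ofNat] at hs
      simp only [LinearMap.coe_mk, AddHom.coe_mk, ENNReal.toReal_ofNat, Real.rpow_ofNat]
      calc ∑ h ∈ s, ‖S h (ξ (σ h))‖ ^ 2 ≤ ∑ h ∈ s, C ^ 2 * ‖ξ (σ h)‖ ^ 2 :=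
            Finset.sum_le_sum fun h _ => key h
        _ = C ^ 2 * ∑ h ∈ s, ‖ξ (σ h)‖ ^ 2 := by rw [Finset.mul_sum]
        _ ≤ C ^ 2 * ‖ξ‖ ^ 2 := by gcongr
        _ = (C * ‖ξ‖) ^ 2 := by ring)

@[simp]
theorem weighted_apply (C : ℝ) (S : G → K →L[ℂ] K) (hS : ∀ h, ‖S h‖ ≤ C) (σ : Equiv.Perm G)
    (ξ : l2 G K) (h : G) : weighted C S hS σ ξ h = S h (ξ (σ h)) := rfl

/-- The copy of `a : A` in the regular representation: `(a ξ)(h) = π (α (h⁻¹) a) (ξ h)`. -/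
def regA (a : A) : l2 G K →L[ℂ] l2 G K :=
  weighted ‖a‖ (fun h => π (T.α h⁻¹ a))
    (fun h => (NonUnitalStarAlgHom.norm_apply_le π _).trans
      (NonUnitalStarAlgHom.norm_apply_le (T.α h⁻¹) a))
    (Equiv.refl G)

/-- The unitary `u g` of the regular representation:
`(u g ξ)(h) = π (ω (h⁻¹) g) (ξ (g⁻¹ * h))`. -/
def regU (g : G) : l2 G K →L[ℂ] l2 G K :=
  weighted ‖(1 : A)‖ (fun h => π (T.ω h⁻¹ g : A))
    (fun h => (NonUnitalStarAlgHom.norm_apply_le π _).trans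
      (by simpa using (CStarRing.norm_coe_unitary_mul (T.ω h⁻¹ g) (1 : A)).le))
    (Equiv.mulLeft g⁻¹)

theorem regA_apply (a : A) (ξ : l2 G K) (h : G) : T.regA π a ξ h = π (T.α h⁻¹ a) (ξ h) := rfl

theorem regU_apply (g : G) (ξ : l2 G K) (h : G) :
    T.regU π g ξ h = π (T.ω h⁻¹ g : A) (ξ (g⁻¹ * h)) := rfl

/-- The reduced twisted crossed product `A ⋊_{α,ω} G`: the C⋆-algebra of operators on `ℓ²(G, K)`
generated by the copy of `A` and the unitaries `u g` of the regular representation induced by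
`π : A → B(K)`. It is meant for faithful `π`, and then does not depend on `π` up to isomorphism. -/
def ReducedCrossedProduct : StarSubalgebra ℂ (l2 G K →L[ℂ] l2 G K) :=
  (StarAlgebra.adjoin ℂ (Set.range (T.regA π) ∪ Set.range (T.regU π))).topologicalClosure

instance : CStarAlgebra (T.ReducedCrossedProduct π) :=
  StarSubalgebra.cstarAlgebra _ (h_closed := StarSubalgebra.isClosed_topologicalClosure _)

end Reduced

section Stabilizer

variable {G : Type*} [Group G] {A : Type*} [CStarAlgebra A] (T : TwistedAction G A)

theorem α_one (a : A) : T.α 1 a = a := by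
  have h := T.α_comp 1 1 a
  rw [T.ω_one_left] at h
  exact (T.α 1).injective (by simpa using h)

/-- The stabilizer `{g : α g q = q}` of a central element `q`. -/
def stabilizer (q : A) (hq : q ∈ Set.center A) : Subgroup G where
  carrier := {g | T.α g q = q}
  one_mem' := T.α_one q
  mul_mem' := fun {s t} hs ht => by
    have h := T.α_comp s t q
    simp only [Set.mem_ofPred_eq] at hs ht ⊢
    rw [ht, hs] at h
    have h' : star (T.ω s t : A) * q * (T.ω s t : A) = T.α (s * t) q := by
      conv_lhs => rw [h]
      rw [← mul_assoc, ← mul_assoc, Unitary.coe_star_mul_self, one_mul, mul_assoc,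
        Unitary.coe_star_mul_self, mul_one]
    rw [← h', mul_assoc, (Semigroup.mem_center_iff.1 hq _).symm, ← mul_assoc]
    simp
  inv_mem' := fun {s} hs => by
    have h := T.α_comp s⁻¹ s q
    simp only [Set.mem_ofPred_eq] at hs ⊢
    rw [hs, inv_mul_cancel, T.α_one, Semigroup.mem_center_iff.1 hq, mul_assoc] at h
    simpa using h

@[simp]
theorem mem_stabilizer {q : A} {hq : q ∈ Set.center A} {g : G} :
    g ∈ T.stabilizer q hq ↔ T.α g q = q := Iff.rfl

end Stabilizer

end TwistedAction

/-- A minimal central projection of a C⋆-algebra: a nonzero central projection that dominates no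
central projections except `0` and itself. -/
def IsMinimalCentralProjection {A : Type*} [CStarAlgebra A] (q : A) : Prop :=
  IsStarProjection q ∧ q ∈ Set.center A ∧ q ≠ 0 ∧
    ∀ r : A, IsStarProjection r → r ∈ Set.center A → r * q = r → r = 0 ∨ r = q

section Summand

variable {ι : Type*} [Fintype ι] [DecidableEq ι] (A : ι → Type*) [∀ i, CStarAlgebra (A i)]

/-- The projection `p i` of `⨁ i, A i` (finite direct sum, i.e. product with the sup norm) onto
the `i`-th summand: the unit of `A i`. -/
def summandProj (i : ι) : Π i, A i := Pi.single i 1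

theorem summandProj_mem_center (i : ι) : summandProj A i ∈ Set.center (Π i, A i) := by
  rw [Semigroup.mem_center_iff]
  intro g
  ext j
  by_cases h : j = i
  · subst h; simp [summandProj]
  · simp [summandProj, h]

variable {A}

theorem eq_single_of_mul_summandProj {i : ι} {x : Π i, A i} (h : x * summandProj A i = x) :
    Pi.single i (x i) = x := by
  conv_rhs => rw [← h]
  ext j
  by_cases hj : j = i
  · subst hj; simp [summandProj]
  · simp [summandProj, hj]

theorem single_mul_summandProj (i : ι) (a : A i) :
    (Pi.single i a : Π i, A i) * summandProj A i = Pi.single i a := by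
  rw [summandProj, ← Pi.single_mul, mul_one]

theorem single_apply_of_fix {i : ι} {φ : (Π i, A i) ≃⋆ₐ[ℂ] (Π i, A i)}
    (hφ : φ (summandProj A i) = summandProj A i) (a : A i) :
    Pi.single i (φ (Pi.single i a) i) = φ (Pi.single i a) := by
  apply eq_single_of_mul_summandProj
  have h := map_mul φ (Pi.single i a) (summandProj A i)
  rw [hφ, single_mul_summandProj] at h
  exact h.symm

/-- An automorphism of `⨁ i, A i` that fixes `p i` restricts to an automorphism of the summand
`A i`. -/
def restrictAut (i : ι) (φ : (Π i, A i) ≃⋆ₐ[ℂ] (Π i, A i))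
    (hφ : φ (summandProj A i) = summandProj A i) : A i ≃⋆ₐ[ℂ] A i :=
  { toFun := fun a => φ (Pi.single i a) i
    invFun := fun a => φ.symm (Pi.single i a) i
    left_inv := fun a => by
      dsimp only
      rw [single_apply_of_fix hφ, StarAlgEquiv.symm_apply_apply, Pi.single_eq_same]
    right_inv := fun a => by
      have hφ' : φ.symm (summandProj A i) = summandProj A i :=
        (congrArg φ.symm hφ).symm.trans (φ.symm_apply_apply _)
      dsimp only
      rw [single_apply_of_fix hφ', StarAlgEquiv.apply_symm_apply, Pi.single_eq_same]
    map_mul' := fun a b => by rw [Pi.single_mul, map_mul]; rfl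
    map_add' := fun a b => by rw [Pi.single_add, map_add]; rfl
    map_star' := fun a => by rw [Pi.single_star, map_star]; rfl
    map_smul' := fun c a => by rw [Pi.single_smul, map_smul]; rfl }

theorem restrictAut_apply (i : ι) (φ : (Π i, A i) ≃⋆ₐ[ℂ] (Π i, A i))
    (hφ : φ (summandProj A i) = summandProj A i) (a : A i) :
    restrictAut i φ hφ a = φ (Pi.single i a) i := rfl

theorem single_restrictAut (i : ι) (φ : (Π i, A i) ≃⋆ₐ[ℂ] (Π i, A i))
    (hφ : φ (summandProj A i) = summandProj A i) (a : A i) :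
    Pi.single i (restrictAut i φ hφ a) = φ (Pi.single i a) :=
  single_apply_of_fix hφ a

/-- The stabilizer `H` of the projection `p i`. -/
abbrev TwistedAction.summandStabilizer {G : Type*} [Group G] (T : TwistedAction G (Π i, A i))
    (i : ι) : Subgroup G :=
  T.stabilizer (summandProj A i) (summandProj_mem_center A i)

/-- The restricted twisted action of the stabilizer `H` of `p i` on the summand `A i`:
`α̃ t a = α t (p i * a)` and `ω̃ s t = p i * ω s t`, both read in `A i`. -/
def TwistedAction.restrict {G : Type*} [Group G] (T : TwistedAction G (Π i, A i)) (i : ι) :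
    TwistedAction (T.summandStabilizer i) (A i) where
  α t := restrictAut i (T.α t) (T.mem_stabilizer.1 t.2)
  ω s t := ⟨(T.ω s t : Π i, A i) i, by
    have h := (T.ω s t).2
    rw [Unitary.mem_iff] at h ⊢
    exact ⟨congrFun h.1 i, congrFun h.2 i⟩⟩
  α_comp s t a := by
    have h := congrFun (T.α_comp s t (Pi.single i a)) i
    rw [restrictAut_apply i (T.α s), single_restrictAut, h]
    rfl
  cocycle r s t := by
    have h := congrFun (T.cocycle r s t) i
    have h1 : T.α r (T.ω s t : Π i, A i) i = T.α r (Pi.single i ((T.ω s t : Π i, A i) i)) i := by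
      have e : (Pi.single i ((T.ω s t : Π i, A i) i) : Π i, A i)
          = (T.ω s t : Π i, A i) * summandProj A i := by
        ext j
        by_cases hj : j = i
        · subst hj; simp [summandProj]
        · simp [summandProj, hj]
      rw [e, map_mul, show T.α r (summandProj A i) = summandProj A i from T.mem_stabilizer.1 r.2]
      simp [summandProj]
    rw [restrictAut_apply]
    refine Eq.trans h ?_
    rw [← h1]
    rfl
  ω_one_left t := by
    ext
    simp [T.ω_one_left]
  ω_one_right t := by
    ext
    simp [T.ω_one_right]

end Summand

end

/-! The representation that makes the isomorphism visible is not the given faithful one but `ρ = π₁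
∘ ev₀`, the representation `π₁` of the chosen summand extended by `0`. It is usually not faithful,
yet by transitivity each summand is carried onto the chosen one by some `α t`, so finitely many
translates `ρ ∘ α t` are jointly faithful.

Changing representation: the matrix entries of a finite sum `∑ f g * u g` are images of elements of
`A` that do not depend on the representation. Its norm is the supremum of the norms of its finite
compressions, which are matrices over `A`, and a jointly faithful family computes the norm of such a
matrix (`norm_regSum_le_of_jointly_faithful`). The regular representations induced by `ρ ∘ α t` and
by `ρ` are intertwined by an isometry (`norm_regSum_comp_α_le`), so `π` and `ρ` give the same norms
and isomorphic closures.

The matrix picture: in the representation induced by `ρ`, the projection of `ℓ²(G, K)` onto `ℓ²(H,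
K)` is the chosen `p` itself (`adjoint_l2Restrict_comp`), and the corner it cuts out is the crossed
product by `H`. If `α (g i)` carries `p` to `p i`, then `u (g i)` carries this corner space onto the
range of `p i`. The `p i` are orthogonal with sum `1`, so these partial isometries are a system of
matrix units, and `x ↦ (Wᵢ⋆ x Wⱼ)` identifies the algebra with matrices over the corner. -/

noncomputable section

open scoped ENNReal

namespace TwistedAction

/-! ### Covariance relations in the regular representation -/

section Relations

variable {G : Type*} [Group G] {A : Type*} [CStarAlgebra A] (T : TwistedAction G A)
  {K : Type*} [NormedAddCommGroup K] [InnerProductSpace ℂ K] [CompleteSpace K]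
  (π : A →⋆ₐ[ℂ] (K →L[ℂ] K))

omit [Group G] [CompleteSpace K] in
theorem clm_l2_ext {E : Type*} [NormedAddCommGroup E] [NormedSpace ℂ E]
    {S S' : E →L[ℂ] l2 G K} (h : ∀ ξ g, S ξ g = S' ξ g) : S = S' :=
  ContinuousLinearMap.ext fun ξ => lp.ext (funext (h ξ))

theorem unitary_conj_mul (u : unitary A) (a : A) : (u : A) * a * star (u : A) * u = u * a := by
  rw [mul_assoc, Unitary.coe_star_mul_self, mul_one]

theorem α_comp_mul (s t : G) (a : A) :
    T.α s (T.α t a) * T.ω s t = T.ω s t * T.α (s * t) a := by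
  rw [T.α_comp, unitary_conj_mul]

theorem regA_add (a b : A) : T.regA π (a + b) = T.regA π a + T.regA π b :=
  clm_l2_ext fun ξ h => by
    simp [regA_apply]

theorem regA_smul (c : ℂ) (a : A) : T.regA π (c • a) = c • T.regA π a :=
  clm_l2_ext fun ξ h => by
    simp [regA_apply]

theorem regA_mul (a b : A) : T.regA π (a * b) = T.regA π a * T.regA π b :=
  clm_l2_ext fun ξ h => by
    simp [regA_apply]

theorem regA_one : T.regA π 1 = 1 :=
  clm_l2_ext fun ξ h => by
    simp [regA_apply]

theorem regA_star (a : A) : T.regA π (star a) = star (T.regA π a) := by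
  rw [ContinuousLinearMap.star_eq_adjoint, ContinuousLinearMap.eq_adjoint_iff]
  intro ξ η
  rw [lp.inner_eq_tsum, lp.inner_eq_tsum]
  refine tsum_congr fun h => ?_
  rw [regA_apply, regA_apply, map_star, map_star, ContinuousLinearMap.star_eq_adjoint,
    ContinuousLinearMap.adjoint_inner_left]

/-- The copy of `A` in the regular representation as a unital `*`-homomorphism. -/
def regAHom : A →⋆ₐ[ℂ] (l2 G K →L[ℂ] l2 G K) where
  toFun := T.regA π
  map_one' := T.regA_one π
  map_mul' := T.regA_mul π
  map_zero' := by simpa using T.regA_smul π 0 0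
  map_add' := T.regA_add π
  commutes' c := by
    rw [Algebra.algebraMap_eq_smul_one, regA_smul, regA_one, Algebra.algebraMap_eq_smul_one]
  map_star' := T.regA_star π

@[simp]
theorem regAHom_apply (a : A) : T.regAHom π a = T.regA π a := rfl

theorem regU_mul_regA (g : G) (a : A) :
    T.regU π g * T.regA π a = T.regA π (T.α g a) * T.regU π g :=
  clm_l2_ext fun ξ h => by
    have := congrArg π (T.α_comp_mul h⁻¹ g a)
    rw [map_mul, map_mul] at this
    simpa [regA_apply, regU_apply] using
      congrArg (fun S : K →L[ℂ] K => S (ξ (g⁻¹ * h))) this.symm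

/-- In the coordinate `h` this is the cocycle identity for `h⁻¹, s, t`. -/
theorem regU_mul_regU (s t : G) :
    T.regU π s * T.regU π t = T.regA π (T.ω s t) * T.regU π (s * t) :=
  clm_l2_ext fun ξ h => by
    have := congrArg π (T.cocycle h⁻¹ s t)
    rw [map_mul, map_mul] at this
    simpa [regA_apply, regU_apply, mul_assoc] using
      congrArg (fun S : K →L[ℂ] K => S (ξ (t⁻¹ * (s⁻¹ * h)))) this

theorem regU_one : T.regU π 1 = 1 :=
  clm_l2_ext fun ξ h => by
    simp [regU_apply, T.ω_one_right]

theorem norm_map_unitary_apply (u : unitary A) (v : K) : ‖π (u : A) v‖ = ‖v‖ := by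
  have h : π (u : A) ∈ unitary (K →L[ℂ] K) := Unitary.map_mem π u.2
  exact ((ContinuousLinearMap.norm_map_iff_adjoint_comp_self _).2
    (Unitary.star_mul_self_of_mem h)) v

theorem norm_weighted_apply {C : ℝ} {S : G → K →L[ℂ] K} (hS : ∀ h, ‖S h‖ ≤ C)
    (hS' : ∀ h v, ‖S h v‖ = ‖v‖) (σ : Equiv.Perm G) (ξ : l2 G K) :
    ‖weighted C S hS σ ξ‖ = ‖ξ‖ := by
  have h2 : (0 : ℝ) < (2 : ℝ≥0∞).toReal := by norm_num
  rw [lp.norm_eq_tsum_rpow h2, lp.norm_eq_tsum_rpow h2]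
  simp only [weighted_apply, hS']
  rw [σ.tsum_eq (fun h => ‖ξ h‖ ^ (2 : ℝ≥0∞).toReal)]

/-- `u g` permutes coordinates and applies a unitary in each of them, hence is isometric. -/
theorem star_regU_mul_regU (g : G) : star (T.regU π g) * T.regU π g = 1 :=
  (ContinuousLinearMap.norm_map_iff_adjoint_comp_self _).1
    (norm_weighted_apply _ (fun h v => norm_map_unitary_apply π (T.ω h⁻¹ g) v) _)

theorem regA_mul_regA_unitary_star (u : unitary A) :
    T.regA π u * T.regA π (star (u : A)) = 1 := by
  rw [← regA_mul, Unitary.mul_star_self_of_mem u.2, regA_one]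

theorem regA_unitary_star_mul_regA (u : unitary A) :
    T.regA π (star (u : A)) * T.regA π u = 1 := by
  rw [← regA_mul, Unitary.coe_star_mul_self, regA_one]

theorem regU_inv_mul (g : G) : T.regU π g⁻¹ * T.regU π g = T.regA π (T.ω g⁻¹ g) := by
  rw [regU_mul_regU, inv_mul_cancel, regU_one, mul_one]

theorem regU_mul_inv (g : G) : T.regU π g * T.regU π g⁻¹ = T.regA π (T.ω g g⁻¹) := by
  rw [regU_mul_regU, mul_inv_cancel, regU_one, mul_one]

theorem star_regU (g : G) :
    star (T.regU π g) = T.regA π (star (T.ω g⁻¹ g : A)) * T.regU π g⁻¹ := by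
  -- `r` is a right inverse of `u g`; both the adjoint and the claimed formula are left inverses, so
  -- each equals `r`.
  set r := T.regU π g⁻¹ * T.regA π (star (T.ω g g⁻¹ : A)) with hr
  have h1 : T.regU π g * r = 1 := by
    rw [hr, ← mul_assoc, regU_mul_inv, regA_mul_regA_unitary_star]
  have h2 : T.regA π (star (T.ω g⁻¹ g : A)) * T.regU π g⁻¹ * T.regU π g = 1 := by
    rw [mul_assoc, regU_inv_mul, regA_unitary_star_mul_regA]
  rw [left_inv_eq_right_inv (T.star_regU_mul_regU π g) h1, left_inv_eq_right_inv h2 h1]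

theorem regU_mul_star_regU (g : G) : T.regU π g * star (T.regU π g) = 1 := by
  set r := T.regU π g⁻¹ * T.regA π (star (T.ω g g⁻¹ : A)) with hr
  have h1 : T.regU π g * r = 1 := by
    rw [hr, ← mul_assoc, regU_mul_inv, regA_mul_regA_unitary_star]
  rw [left_inv_eq_right_inv (T.star_regU_mul_regU π g) h1, h1]

theorem regA_mul_regU_mul (a b : A) (s t : G) :
    (T.regA π a * T.regU π s) * (T.regA π b * T.regU π t) =
      T.regA π (a * T.α s b * T.ω s t) * T.regU π (s * t) := by
  calc _ = T.regA π a * (T.regU π s * T.regA π b) * T.regU π t := by simp only [mul_assoc]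
    _ = T.regA π a * T.regA π (T.α s b) * (T.regU π s * T.regU π t) := by
      rw [regU_mul_regA]; simp only [mul_assoc]
    _ = _ := by rw [regU_mul_regU, regA_mul, regA_mul]; simp only [mul_assoc]

theorem star_regA_mul_regU (a : A) (g : G) :
    star (T.regA π a * T.regU π g) =
      T.regA π (star (T.ω g⁻¹ g : A) * T.α g⁻¹ (star a)) * T.regU π g⁻¹ := by
  rw [star_mul, star_regU, ← regA_star, mul_assoc, regU_mul_regA, ← mul_assoc, ← regA_mul]

theorem star_regU_mul_regA_mul_regU (s t : G) (a : A) :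
    star (T.regU π s) * T.regA π a * T.regU π t =
      T.regA π (star (T.ω s⁻¹ s : A) * T.α s⁻¹ a * T.ω s⁻¹ t) * T.regU π (s⁻¹ * t) := by
  rw [star_regU, mul_assoc, ← regA_mul_regU_mul]

theorem regU_mul_regA_mul_star_regU (g : G) (a : A) :
    T.regU π g * T.regA π a * star (T.regU π g) = T.regA π (T.α g a) := by
  rw [regU_mul_regA, mul_assoc, regU_mul_star_regU, mul_one]

end Relations

end TwistedAction

/-! ### Matrices over `A` acting through isometries with orthogonal ranges -/

section MatrixAmplification

open ContinuousLinearMap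

variable {I : Type*} [Fintype I] [DecidableEq I] {A : Type*} [CStarAlgebra A]
  {L M : Type*} [NormedAddCommGroup L] [InnerProductSpace ℂ L] [CompleteSpace L]
  [NormedAddCommGroup M] [InnerProductSpace ℂ M] [CompleteSpace M]

/-- Isometries `W i : L → M` with mutually orthogonal ranges turn a representation of `A` on `L`
into a representation on `M` of the matrices over `A`. -/
def matrixAmplification (W : I → L →L[ℂ] M)
    (hW : ∀ i j, adjoint (W i) ∘L W j = if i = j then .id ℂ L else 0) (π : A →⋆ₐ[ℂ] (L →L[ℂ] L)) :
    CStarMatrix I I A →⋆ₙₐ[ℂ] (M →L[ℂ] M) where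
  toFun X := ∑ i, ∑ j, W i ∘L π (X i j) ∘L adjoint (W j)
  map_smul' c X := by simp [Finset.smul_sum]
  map_zero' := by simp [CStarMatrix.zero_apply]
  map_add' X Y := by
    simp [Finset.sum_add_distrib, ContinuousLinearMap.comp_add, ContinuousLinearMap.add_comp]
  map_mul' X Y := by
    have key : ∀ i j k l, (W i ∘L π (X i j) ∘L adjoint (W j)) *
        (W k ∘L π (Y k l) ∘L adjoint (W l)) =
        if j = k then W i ∘L π (X i j * Y k l) ∘L adjoint (W l) else 0 := fun i j k l => by
      have : (W i ∘L π (X i j) ∘L adjoint (W j)) * (W k ∘L π (Y k l) ∘L adjoint (W l)) =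
        W i ∘L π (X i j) ∘L (adjoint (W j) ∘L W k) ∘L π (Y k l) ∘L adjoint (W l) := rfl
      rw [this, hW]
      split_ifs
      · rw [map_mul]; rfl
      · simp
    rw [Finset.sum_mul_sum]
    refine Finset.sum_congr rfl fun i _ => ?_
    simp only [Finset.sum_mul_sum, key]
    rw [Finset.sum_comm]
    simp only [CStarMatrix.mul_apply, map_sum, finsetSum_comp, comp_finsetSum]
    rw [Finset.sum_comm]
    simp
  map_star' X := by
    rw [star_eq_adjoint, map_sum, Finset.sum_comm]
    refine Finset.sum_congr rfl fun i _ => ?_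
    rw [map_sum]
    refine Finset.sum_congr rfl fun j _ => ?_
    rw [adjoint_comp, adjoint_comp, adjoint_adjoint, CStarMatrix.star_apply, map_star,
      star_eq_adjoint]
    rfl

theorem matrixAmplification_apply (W : I → L →L[ℂ] M)
    (hW : ∀ i j, adjoint (W i) ∘L W j = if i = j then .id ℂ L else 0) (π : A →⋆ₐ[ℂ] (L →L[ℂ] L))
    (X : CStarMatrix I I A) :
    matrixAmplification W hW π X = ∑ i, ∑ j, W i ∘L π (X i j) ∘L adjoint (W j) := rfl

theorem adjoint_comp_matrixAmplification_comp (W : I → L →L[ℂ] M)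
    (hW : ∀ i j, adjoint (W i) ∘L W j = if i = j then .id ℂ L else 0) (π : A →⋆ₐ[ℂ] (L →L[ℂ] L))
    (X : CStarMatrix I I A) (i j : I) :
    adjoint (W i) ∘L matrixAmplification W hW π X ∘L W j = π (X i j) := by
  have key : ∀ k l, adjoint (W i) ∘L (W k ∘L π (X k l) ∘L adjoint (W l)) ∘L W j =
      if k = i then if l = j then π (X k l) else 0 else 0 := fun k l => by
    have : adjoint (W i) ∘L (W k ∘L π (X k l) ∘L adjoint (W l)) ∘L W j =
      (adjoint (W i) ∘L W k) ∘L π (X k l) ∘L (adjoint (W l) ∘L W j) := rfl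
    rw [this, hW, hW]
    simp only [eq_comm (a := i)]
    split_ifs <;> simp
  simp [matrixAmplification_apply, ContinuousLinearMap.comp_finsetSum,
    ContinuousLinearMap.finsetSum_comp, key]

theorem matrixAmplification_injective (W : I → L →L[ℂ] M)
    (hW : ∀ i j, adjoint (W i) ∘L W j = if i = j then .id ℂ L else 0) {π : A →⋆ₐ[ℂ] (L →L[ℂ] L)}
    (hπ : Function.Injective π) : Function.Injective (matrixAmplification W hW π) :=
  fun X Y h => CStarMatrix.ext fun i j => hπ <| by
    rw [← adjoint_comp_matrixAmplification_comp W hW, h, adjoint_comp_matrixAmplification_comp]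

end MatrixAmplification

namespace TwistedAction

open ContinuousLinearMap

/-! ### Finite coordinate projections of `ℓ²(G, K)` -/

section Corners

variable {G K : Type*} [DecidableEq G] [NormedAddCommGroup K] [InnerProductSpace ℂ K]
  [CompleteSpace K]

/-- The isometry of `K` onto the `g`-th coordinate of `ℓ²(G, K)`. -/
def l2Single (K : Type*) [NormedAddCommGroup K] [InnerProductSpace ℂ K] (g : G) :
    K →L[ℂ] l2 G K :=
  lp.singleContinuousLinearMap ℂ (fun _ : G => K) 2 g

omit [CompleteSpace K] in
theorem l2Single_apply_apply (g h : G) (v : K) :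
    l2Single K g v h = if h = g then v else 0 := by
  simp only [l2Single, lp.singleContinuousLinearMap_apply, lp.single_apply, Pi.single_apply]

theorem adjoint_l2Single_apply (g : G) (ξ : l2 G K) : adjoint (l2Single K g) ξ = ξ g := by
  refine ext_inner_left ℂ fun v => ?_
  rw [adjoint_inner_right]
  exact lp.inner_single_left (𝕜 := ℂ) (G := fun _ : G => K) g v ξ

theorem adjoint_l2Single_comp (g h : G) :
    adjoint (l2Single K g) ∘L l2Single K h = if g = h then .id ℂ K else 0 := by
  ext v
  rw [comp_apply, adjoint_l2Single_apply, l2Single_apply_apply]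
  split_ifs <;> rfl

variable (K) in
/-- The projection of `ℓ²(G, K)` onto the coordinates in a finite set. -/
def finiteProj (F : Finset G) : l2 G K →L[ℂ] l2 G K :=
  ∑ g : F, l2Single K (g : G) ∘L adjoint (l2Single K (g : G))

theorem finiteProj_apply (F : Finset G) (ξ : l2 G K) :
    finiteProj K F ξ = ∑ g ∈ F, lp.single 2 g (ξ g) := by
  rw [finiteProj, sum_apply, ← Finset.sum_coe_sort F fun g => (lp.single 2 g (ξ g) : l2 G K)]
  refine Finset.sum_congr rfl fun g _ => ?_
  rw [comp_apply, adjoint_l2Single_apply]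
  rfl

theorem adjoint_finiteProj (F : Finset G) : adjoint (finiteProj K F) = finiteProj K F := by
  simp [finiteProj, map_sum, adjoint_comp]

theorem tendsto_finiteProj (ξ : l2 G K) :
    Filter.Tendsto (fun F : Finset G => finiteProj K F ξ) Filter.atTop (nhds ξ) := by
  simp_rw [finiteProj_apply]
  exact lp.hasSum_single (by norm_num) ξ

/-- The finite projections converge strongly to `1`, so every `⟨η, S ξ⟩` is a limit of the same
expression for compressions of `S`. -/
theorem norm_le_of_forall_finiteProj {S : l2 G K →L[ℂ] l2 G K} {C : ℝ} (hC : 0 ≤ C)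
    (h : ∀ F : Finset G, ‖finiteProj K F ∘L S ∘L finiteProj K F‖ ≤ C) : ‖S‖ ≤ C := by
  have h1 : ∀ ξ η : l2 G K, ‖inner ℂ η (S ξ)‖ ≤ C * ‖η‖ * ‖ξ‖ := fun ξ η => by
    have ht : Filter.Tendsto (fun F : Finset G =>
        ‖inner ℂ (finiteProj K F η) (S (finiteProj K F ξ))‖) Filter.atTop
        (nhds ‖inner ℂ η (S ξ)‖) :=
      ((tendsto_finiteProj η).inner ((S.continuous.tendsto ξ).comp (tendsto_finiteProj ξ))).norm
    refine le_of_tendsto' ht fun F => ?_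
    rw [← adjoint_finiteProj, adjoint_inner_left, adjoint_finiteProj]
    calc _ ≤ ‖η‖ * ‖(finiteProj K F ∘L S ∘L finiteProj K F) ξ‖ := norm_inner_le_norm _ _
      _ ≤ ‖η‖ * (C * ‖ξ‖) := by
        gcongr
        exact le_of_opNorm_le _ (h F) ξ
      _ = _ := by ring
  refine opNorm_le_bound _ hC fun ξ => ?_
  by_cases h0 : ‖S ξ‖ = 0
  · rw [h0]; positivity
  have h2 := h1 ξ (S ξ)
  rw [inner_self_eq_norm_sq_to_K, norm_pow, RCLike.norm_ofReal, abs_norm] at h2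
  have h3 : 0 < ‖S ξ‖ := lt_of_le_of_ne (norm_nonneg _) (Ne.symm h0)
  nlinarith

theorem norm_finiteProj_le (F : Finset G) : ‖finiteProj K F‖ ≤ 1 := by
  have h : finiteProj K F ∘L finiteProj K F = finiteProj K F := by
    have key : ∀ g h : F, (l2Single K (g : G) ∘L adjoint (l2Single K (g : G))) ∘L
        (l2Single K (h : G) ∘L adjoint (l2Single K (h : G))) =
        if g = h then l2Single K (g : G) ∘L adjoint (l2Single K (g : G)) else 0 := fun g h => by
      have : (l2Single K (g : G) ∘L adjoint (l2Single K (g : G))) ∘L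
        (l2Single K (h : G) ∘L adjoint (l2Single K (h : G))) = l2Single K (g : G) ∘L
          (adjoint (l2Single K (g : G)) ∘L l2Single K (h : G)) ∘L
            adjoint (l2Single K (h : G)) := rfl
      rw [this, adjoint_l2Single_comp]
      simp only [Subtype.coe_inj]
      split_ifs with e
      · rw [e]; rfl
      · simp
    simp [finiteProj, finsetSum_comp, comp_finsetSum, key]
  exact IsStarProjection.norm_le _ ⟨h, adjoint_finiteProj F⟩

end Corners

/-! ### Norms of finite sums via matrices over `A` -/

section AlgebraicPart

variable {G : Type*} [Group G] {A : Type*} [CStarAlgebra A] (T : TwistedAction G A)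
  {K : Type*} [NormedAddCommGroup K] [InnerProductSpace ℂ K] [CompleteSpace K]
  (π : A →⋆ₐ[ℂ] (K →L[ℂ] K))

/-- The regular representation on finite sums: `f ↦ ∑ g, f g * u g`. -/
def regSum : (G →₀ A) →ₗ[ℂ] (l2 G K →L[ℂ] l2 G K) :=
  Finsupp.lsum ℂ fun g => LinearMap.mulRight ℂ (T.regU π g) ∘ₗ (T.regAHom π).toAlgHom.toLinearMap

@[simp]
theorem regSum_single (g : G) (a : A) :
    T.regSum π (Finsupp.single g a) = T.regA π a * T.regU π g := by
  rw [regSum, Finsupp.lsum_single]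
  rfl

/-- The matrix over `A` of a finite sum `∑ g, f g * u g` in the regular representation. -/
def regCoeff (f : G →₀ A) (h k : G) : A :=
  T.α h⁻¹ (f (h * k⁻¹)) * T.ω h⁻¹ (h * k⁻¹)

/-- The representation enters only by being applied to an element of `A` that is independent of it;
this is what allows different representations to be compared. -/
theorem adjoint_l2Single_comp_regSum_comp [DecidableEq G] (f : G →₀ A) (h k : G) :
    adjoint (l2Single K h) ∘L T.regSum π f ∘L l2Single K k = π (T.regCoeff f h k) := by
  induction f using Finsupp.induction_linear with
  | zero => simp [regCoeff]
  | add f₁ f₂ h₁ h₂ =>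
    have : T.regCoeff (f₁ + f₂) h k = T.regCoeff f₁ h k + T.regCoeff f₂ h k := by
      simp [regCoeff, add_mul]
    rw [this, map_add, map_add, add_comp, comp_add, h₁, h₂]
  | single g a =>
    ext v
    rw [comp_apply, adjoint_l2Single_apply, regSum_single, comp_apply, mul_def, comp_apply, regA_apply,
      regU_apply, l2Single_apply_apply, regCoeff, Finsupp.single_apply]
    by_cases hg : g = h * k⁻¹
    · subst hg; simp
    · have : ¬ g⁻¹ * h = k := fun e => hg (by rw [← e]; group)
      simp [hg, this]

/-- The matrix of a finite sum `∑ g, f g * u g`, compressed to a finite set of coordinates. -/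
def regMatrix (f : G →₀ A) (F : Finset G) : CStarMatrix F F A :=
  CStarMatrix.ofMatrix fun h k => T.regCoeff f h k

variable [DecidableEq G]

/-- The representation of matrices over `A` on the coordinates of `ℓ²(G, K)` in a finite set. -/
def finiteAmplification (F : Finset G) : CStarMatrix F F A →⋆ₙₐ[ℂ] (l2 G K →L[ℂ] l2 G K) :=
  matrixAmplification (fun g : F => l2Single K (g : G))
    (fun g h => by rw [adjoint_l2Single_comp]; simp only [Subtype.coe_inj]) π

theorem finiteAmplification_regMatrix (f : G →₀ A) (F : Finset G) :
    finiteAmplification π F (T.regMatrix f F) =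
      finiteProj K F ∘L T.regSum π f ∘L finiteProj K F := by
  rw [finiteAmplification, matrixAmplification_apply, finiteProj, finsetSum_comp]
  refine Finset.sum_congr rfl fun g _ => ?_
  rw [comp_finsetSum, comp_finsetSum]
  refine Finset.sum_congr rfl fun h _ => ?_
  have : T.regMatrix f F g h = T.regCoeff f g h := rfl
  rw [this, ← adjoint_l2Single_comp_regSum_comp]
  rfl

omit [Group G] in
theorem norm_finiteProj_comp_le (S : l2 G K →L[ℂ] l2 G K) (F : Finset G) :
    ‖finiteProj K F ∘L S ∘L finiteProj K F‖ ≤ ‖S‖ := by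
  calc _ ≤ ‖finiteProj K F‖ * (‖S‖ * ‖finiteProj K F‖) :=
        (opNorm_comp_le _ _).trans (by gcongr; exact opNorm_comp_le _ _)
    _ ≤ 1 * (‖S‖ * 1) := by gcongr <;> exact norm_finiteProj_le F
    _ = _ := by ring

/-- The norm of a finite sum in the regular representation is controlled by its norms in the
regular representations of any jointly faithful finite family of representations. -/
theorem norm_regSum_le_of_jointly_faithful {J L : Type*} [Fintype J] [NormedAddCommGroup L]
    [InnerProductSpace ℂ L] [CompleteSpace L] {ρ : J → A →⋆ₐ[ℂ] (L →L[ℂ] L)}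
    (hρ : ∀ a, (∀ j, ρ j a = 0) → a = 0) {f : G →₀ A} {C : ℝ} (hC : 0 ≤ C)
    (h : ∀ j, ‖T.regSum (ρ j) f‖ ≤ C) : ‖T.regSum π f‖ ≤ C := by
  refine norm_le_of_forall_finiteProj hC fun F => ?_
  -- The order is needed for the C⋆-norm on matrices over `A`.
  let _ := CStarAlgebra.spectralOrder A
  have := CStarAlgebra.spectralOrderedRing A
  rw [← finiteAmplification_regMatrix]
  -- Contractivity bounds the compression by the norm of its matrix over `A`, whether or not `π` is
  -- faithful. That norm is then computed through `Φ`, isometric because injective.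
  refine (NonUnitalStarAlgHom.norm_apply_le _ _).trans ?_
  let Φ : CStarMatrix F F A →⋆ₙₐ[ℂ] (J → l2 G L →L[ℂ] l2 G L) :=
    { toFun := fun X j => finiteAmplification (ρ j) F X
      map_smul' := fun c X => funext fun j => map_smul _ _ _
      map_zero' := funext fun j => map_zero _
      map_add' := fun X Y => funext fun j => map_add _ _ _
      map_mul' := fun X Y => funext fun j => map_mul _ _ _
      map_star' := fun X => funext fun j => map_star _ _ }
  have hΦ : Function.Injective Φ := by
    rw [injective_iff_map_eq_zero]
    intro X hX
    ext g k
    refine hρ _ fun j => ?_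
    have : finiteAmplification (ρ j) F X = 0 := congrFun hX j
    rw [← adjoint_comp_matrixAmplification_comp (fun g : F => l2Single L (g : G))
      (fun g h => by rw [adjoint_l2Single_comp]; simp only [Subtype.coe_inj]) (ρ j) X g k]
    rw [finiteAmplification] at this
    rw [this]
    simp
  rw [← NonUnitalStarAlgHom.norm_map Φ hΦ, pi_norm_le_iff_of_nonneg hC]
  intro j
  change ‖finiteAmplification (ρ j) F _‖ ≤ C
  rw [finiteAmplification_regMatrix]
  exact (norm_finiteProj_comp_le _ _).trans (h j)

end AlgebraicPart

/-! ### Intertwining the representations induced by `π ∘ α t` and `π` -/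

section Translation

variable {G : Type*} [Group G] {A : Type*} [CStarAlgebra A] (T : TwistedAction G A)
  {K : Type*} [NormedAddCommGroup K] [InnerProductSpace ℂ K] [CompleteSpace K]
  (π : A →⋆ₐ[ℂ] (K →L[ℂ] K))

/-- The unitary `ℓ²(G, K) → ℓ²(G, K)` intertwining the regular representations induced by
`π ∘ α t` and by `π`: `ξ ↦ (k ↦ π (ω t (t⁻¹ * k⁻¹))⋆ (ξ (k * t)))`. -/
def translation (t : G) : l2 G K →L[ℂ] l2 G K :=
  weighted ‖(1 : A)‖ (fun k => π (star (T.ω t (t⁻¹ * k⁻¹)) : unitary A))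
    (fun k => (NonUnitalStarAlgHom.norm_apply_le π _).trans
      (by simpa using (CStarRing.norm_coe_unitary_mul (star (T.ω t (t⁻¹ * k⁻¹))) (1 : A)).le))
    (Equiv.mulRight t)

theorem translation_apply (t : G) (ξ : l2 G K) (k : G) :
    T.translation π t ξ k = π (star (T.ω t (t⁻¹ * k⁻¹) : A)) (ξ (k * t)) := rfl

theorem norm_translation_apply (t : G) (ξ : l2 G K) : ‖T.translation π t ξ‖ = ‖ξ‖ :=
  norm_weighted_apply _ (fun _ v => norm_map_unitary_apply π _ v) _ _

theorem translation_mul_regA (t : G) (a : A) :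
    T.translation π t * T.regA (π.comp (T.α t : A →⋆ₐ[ℂ] A)) a =
      T.regA π a * T.translation π t :=
  clm_l2_ext fun ξ k => by
    have h : star (T.ω t (t⁻¹ * k⁻¹) : A) * T.α t (T.α (t⁻¹ * k⁻¹) a) =
        T.α k⁻¹ a * star (T.ω t (t⁻¹ * k⁻¹) : A) := by
      rw [T.α_comp, mul_inv_cancel_left, mul_assoc, ← mul_assoc, Unitary.coe_star_mul_self,
        one_mul]
    have := congrArg π h
    rw [map_mul, map_mul] at this
    simpa [regA_apply, translation_apply] using
      congrArg (fun S : K →L[ℂ] K => S (ξ (k * t))) this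

theorem translation_mul_regU (t g : G) :
    T.translation π t * T.regU (π.comp (T.α t : A →⋆ₐ[ℂ] A)) g =
      T.regU π g * T.translation π t :=
  clm_l2_ext fun ξ k => by
    -- The cocycle identity for `t, t⁻¹ * k⁻¹, g`, rearranged.
    have h : star (T.ω t (t⁻¹ * k⁻¹) : A) * T.α t (T.ω (t⁻¹ * k⁻¹) g) =
        T.ω k⁻¹ g * star (T.ω t (t⁻¹ * (g⁻¹ * k)⁻¹) : A) := by
      have h := T.cocycle t (t⁻¹ * k⁻¹) g
      have e : t⁻¹ * (g⁻¹ * k)⁻¹ = t⁻¹ * k⁻¹ * g := by group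
      rw [mul_inv_cancel_left] at h
      calc _ = star (T.ω t (t⁻¹ * k⁻¹) : A) * (T.α t (T.ω (t⁻¹ * k⁻¹) g) *
              T.ω t (t⁻¹ * k⁻¹ * g)) * star (T.ω t (t⁻¹ * k⁻¹ * g) : A) := by
            rw [mul_assoc, mul_assoc, Unitary.mul_star_self_of_mem (T.ω _ _).2, mul_one]
        _ = _ := by
            rw [← h, ← mul_assoc, Unitary.coe_star_mul_self, one_mul, e]
    have := congrArg π h
    rw [map_mul, map_mul] at this
    simpa [regU_apply, translation_apply, mul_assoc] using
      congrArg (fun S : K →L[ℂ] K => S (ξ (g⁻¹ * (k * t)))) this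

theorem translation_mul_regSum (t : G) (f : G →₀ A) :
    T.translation π t * T.regSum (π.comp (T.α t : A →⋆ₐ[ℂ] A)) f =
      T.regSum π f * T.translation π t := by
  induction f using Finsupp.induction_linear with
  | zero => simp
  | add f₁ f₂ h₁ h₂ => rw [map_add, map_add, mul_add, add_mul, h₁, h₂]
  | single g a =>
    rw [regSum_single, regSum_single, ← mul_assoc, translation_mul_regA, mul_assoc,
      translation_mul_regU, mul_assoc]

theorem norm_regSum_comp_α_le (t : G) (f : G →₀ A) :
    ‖T.regSum (π.comp (T.α t : A →⋆ₐ[ℂ] A)) f‖ ≤ ‖T.regSum π f‖ :=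
  opNorm_le_bound _ (norm_nonneg _) fun ξ => by
    rw [← norm_translation_apply T π t, ← norm_translation_apply T π t ξ, ← comp_apply,
      ← mul_def, translation_mul_regSum]
    exact (T.regSum π f).le_opNorm (T.translation π t ξ)

end Translation

end TwistedAction

/-! ### Extending an isometric identification to closures -/

section ClosureEquiv

variable {E C : Type*} [CStarAlgebra E] [CStarAlgebra C]

open StarAlgebra in
/-- A `*`-homomorphism that is isometric on the `*`-algebra generated by `S` identifies the
C⋆-algebras generated by `S` and by the image of `S`. -/
theorem nonempty_starAlgEquiv_adjoin_image (f : E →⋆ₐ[ℂ] C) (S : Set E)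
    (hf : ∀ d ∈ adjoin ℂ S, ‖f d‖ = ‖d‖) :
    Nonempty ((adjoin ℂ S).topologicalClosure ≃⋆ₐ[ℂ] (adjoin ℂ (f '' S)).topologicalClosure) := by
  have hc : Continuous f := (AddMonoidHomClass.continuous_of_bound f 1
    (by simpa using! NonUnitalStarAlgHom.norm_apply_le f))
  have hn : ∀ d ∈ (adjoin ℂ S).topologicalClosure, ‖f d‖ = ‖d‖ := fun d hd =>
    closure_minimal (s := (adjoin ℂ S : Set E)) (t := {d | ‖f d‖ = ‖d‖}) hf
      (isClosed_eq hc.norm continuous_norm) hd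
  have hmem : ∀ d ∈ (adjoin ℂ S).topologicalClosure,
      f d ∈ (adjoin ℂ (f '' S)).topologicalClosure := fun d hd => by
    rw [← StarAlgHom.map_adjoin]
    exact map_mem_closure hc hd fun x hx => ⟨x, hx, rfl⟩
  let g : (adjoin ℂ S).topologicalClosure →⋆ₐ[ℂ] (adjoin ℂ (f '' S)).topologicalClosure :=
    (f.comp (adjoin ℂ S).topologicalClosure.subtype).codRestrict _ fun d => hmem d d.2
  refine ⟨StarAlgEquiv.ofBijective g ⟨?_, ?_⟩⟩
  · rw [injective_iff_map_eq_zero]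
    intro d hd
    have h0 : f d = 0 := congrArg Subtype.val hd
    have h1 := hn d d.2
    rw [h0, norm_zero] at h1
    exact Subtype.ext (norm_eq_zero.1 h1.symm)
  -- Surjectivity: the isometric image of a complete space is closed, and it contains the dense
  -- subalgebra generated by `f '' S`.
  · have hiso : Isometry fun d : (adjoin ℂ S).topologicalClosure => f d :=
      AddMonoidHomClass.isometry_of_norm (f.comp (adjoin ℂ S).topologicalClosure.subtype)
        fun d => hn d d.2
    have hcl : IsClosed (Set.range fun d : (adjoin ℂ S).topologicalClosure => f d) := by
      have : CompleteSpace (adjoin ℂ S).topologicalClosure :=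
        (adjoin ℂ S).isClosed_topologicalClosure.completeSpace_coe
      exact hiso.isClosedEmbedding.isClosed_range
    rintro ⟨y, hy⟩
    have hsub : (adjoin ℂ (f '' S) : Set C) ⊆
        Set.range fun d : (adjoin ℂ S).topologicalClosure => f d := by
      rw [← StarAlgHom.map_adjoin]
      rintro _ ⟨x, hx, rfl⟩
      exact ⟨⟨x, (adjoin ℂ S).le_topologicalClosure hx⟩, rfl⟩
    obtain ⟨d, hd⟩ := closure_minimal hsub hcl hy
    exact ⟨d, Subtype.ext hd⟩

end ClosureEquiv

namespace TwistedAction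

open ContinuousLinearMap

/-! ### Independence of the inducing representation -/

section Comparison

variable {G : Type*} [Group G] {A : Type*} [CStarAlgebra A] (T : TwistedAction G A)
  {K : Type*} [NormedAddCommGroup K] [InnerProductSpace ℂ K] [CompleteSpace K]
  (π : A →⋆ₐ[ℂ] (K →L[ℂ] K))
  {L : Type*} [NormedAddCommGroup L] [InnerProductSpace ℂ L] [CompleteSpace L]
  (ρ : A →⋆ₐ[ℂ] (L →L[ℂ] L))

theorem regSum_single_mul_regSum_single (a b : A) (s t : G) :
    T.regSum π (Finsupp.single s a) * T.regSum π (Finsupp.single t b) =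
      T.regSum π (Finsupp.single (s * t) (a * T.α s b * T.ω s t)) := by
  simp only [regSum_single, regA_mul_regU_mul]

theorem star_regSum_single (a : A) (g : G) :
    star (T.regSum π (Finsupp.single g a)) =
      T.regSum π (Finsupp.single g⁻¹ (star (T.ω g⁻¹ g : A) * T.α g⁻¹ (star a))) := by
  simp only [regSum_single, star_regA_mul_regU]

/-- Finite sums `∑ g, f g * u g` in two regular representations at once. -/
def regSumPair : (G →₀ A) →ₗ[ℂ] (l2 G K →L[ℂ] l2 G K) × (l2 G L →L[ℂ] l2 G L) :=
  (T.regSum π).prod (T.regSum ρ)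

theorem regSumPair_apply (f : G →₀ A) :
    T.regSumPair π ρ f = (T.regSum π f, T.regSum ρ f) := rfl

/-- The product of two terms `a * u s` and `b * u t` is again such a term, with a coefficient
computed in `A` and so common to both representations. -/
theorem mul_mem_range_regSumPair {x y : (l2 G K →L[ℂ] l2 G K) × (l2 G L →L[ℂ] l2 G L)}
    (hx : x ∈ LinearMap.range (T.regSumPair π ρ)) (hy : y ∈ LinearMap.range (T.regSumPair π ρ)) :
    x * y ∈ LinearMap.range (T.regSumPair π ρ) := by
  obtain ⟨f, rfl⟩ := hx
  obtain ⟨f', rfl⟩ := hy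
  induction f using Finsupp.induction_linear with
  | zero => rw [map_zero, zero_mul]; exact Submodule.zero_mem _
  | add f₁ f₂ h₁ h₂ => rw [map_add, add_mul]; exact Submodule.add_mem _ h₁ h₂
  | single s a =>
    induction f' using Finsupp.induction_linear with
    | zero => rw [map_zero, mul_zero]; exact Submodule.zero_mem _
    | add f₁ f₂ h₁ h₂ => rw [map_add, mul_add]; exact Submodule.add_mem _ h₁ h₂
    | single t b =>
      refine ⟨Finsupp.single (s * t) (a * T.α s b * T.ω s t), ?_⟩
      simp only [regSumPair_apply, Prod.mk_mul_mk, regSum_single_mul_regSum_single]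

theorem star_mem_range_regSumPair {x : (l2 G K →L[ℂ] l2 G K) × (l2 G L →L[ℂ] l2 G L)}
    (hx : x ∈ LinearMap.range (T.regSumPair π ρ)) :
    star x ∈ LinearMap.range (T.regSumPair π ρ) := by
  obtain ⟨f, rfl⟩ := hx
  induction f using Finsupp.induction_linear with
  | zero => rw [map_zero, star_zero]; exact Submodule.zero_mem _
  | add f₁ f₂ h₁ h₂ => rw [map_add, star_add]; exact Submodule.add_mem _ h₁ h₂
  | single g a =>
    refine ⟨Finsupp.single g⁻¹ (star (T.ω g⁻¹ g : A) * T.α g⁻¹ (star a)), ?_⟩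
    rw [regSumPair_apply, regSumPair_apply, ← star_regSum_single, ← star_regSum_single]
    rfl

theorem adjoin_pairs_subset_range_regSumPair
    {x : (l2 G K →L[ℂ] l2 G K) × (l2 G L →L[ℂ] l2 G L)}
    (hx : x ∈ StarAlgebra.adjoin ℂ ((Set.range fun a => (T.regA π a, T.regA ρ a)) ∪
      Set.range fun g => (T.regU π g, T.regU ρ g))) :
    x ∈ LinearMap.range (T.regSumPair π ρ) := by
  induction hx using StarAlgebra.adjoin_induction with
  | mem x hx =>
    rcases hx with ⟨a, rfl⟩ | ⟨g, rfl⟩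
    · exact ⟨Finsupp.single 1 a, by simp [regSumPair_apply, regU_one]⟩
    · exact ⟨Finsupp.single g 1, by simp [regSumPair_apply, regA_one]⟩
  | algebraMap c =>
    refine ⟨Finsupp.single 1 (c • 1), ?_⟩
    rw [Algebra.algebraMap_eq_smul_one]
    simp only [regSumPair_apply, regSum_single, regA_smul, regA_one, regU_one, mul_one]
    rfl
  | add x y _ _ h₁ h₂ => exact Submodule.add_mem _ h₁ h₂
  | mul x y _ _ h₁ h₂ => exact T.mul_mem_range_regSumPair π ρ h₁ h₂
  | star x _ h => exact T.star_mem_range_regSumPair π ρ h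

/-- Two regular representations with the same norms on finite sums generate isomorphic
C⋆-algebras. -/
theorem nonempty_starAlgEquiv_of_norm_regSum_eq
    (h : ∀ f : G →₀ A, ‖T.regSum π f‖ = ‖T.regSum ρ f‖) :
    Nonempty (T.ReducedCrossedProduct π ≃⋆ₐ[ℂ] T.ReducedCrossedProduct ρ) := by
  set S := (Set.range fun a => (T.regA π a, T.regA ρ a)) ∪
    Set.range fun g => (T.regU π g, T.regU ρ g) with hS
  have hn : ∀ d ∈ StarAlgebra.adjoin ℂ S, ‖d.1‖ = ‖d.2‖ := fun d hd => by
    obtain ⟨f, rfl⟩ := T.adjoin_pairs_subset_range_regSumPair π ρ hd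
    exact h f
  -- The norm of a pair is the maximum of two equal norms, so both coordinate projections are
  -- isometric on the algebra generated by the pairs.
  obtain ⟨e₁⟩ := nonempty_starAlgEquiv_adjoin_image
    (StarAlgHom.fst ℂ (l2 G K →L[ℂ] l2 G K) (l2 G L →L[ℂ] l2 G L)) S
    fun d hd => by
      rw [Prod.norm_def, ← hn d hd, max_self]; rfl
  obtain ⟨e₂⟩ := nonempty_starAlgEquiv_adjoin_image
    (StarAlgHom.snd ℂ (l2 G K →L[ℂ] l2 G K) (l2 G L →L[ℂ] l2 G L)) S
    fun d hd => by
      rw [Prod.norm_def, hn d hd, max_self]; rfl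
  have h₁ : StarAlgHom.fst ℂ (l2 G K →L[ℂ] l2 G K) (l2 G L →L[ℂ] l2 G L) '' S =
      Set.range (T.regA π) ∪ Set.range (T.regU π) := by
    rw [hS, Set.image_union, ← Set.range_comp, ← Set.range_comp]; rfl
  have h₂ : StarAlgHom.snd ℂ (l2 G K →L[ℂ] l2 G K) (l2 G L →L[ℂ] l2 G L) '' S =
      Set.range (T.regA ρ) ∪ Set.range (T.regU ρ) := by
    rw [hS, Set.image_union, ← Set.range_comp, ← Set.range_comp]; rfl
  rw [h₁] at e₁
  rw [h₂] at e₂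
  exact ⟨e₁.symm.trans e₂⟩

/-- If finitely many translates of `ρ` are jointly faithful, then the regular representation
induced by `ρ` generates the reduced crossed product. -/
theorem nonempty_starAlgEquiv_of_translates_jointly_faithful (hπ : Function.Injective π)
    {J : Type*} [Fintype J] (t : J → G) (hρ : ∀ a, (∀ j, ρ (T.α (t j) a) = 0) → a = 0) :
    Nonempty (T.ReducedCrossedProduct π ≃⋆ₐ[ℂ] T.ReducedCrossedProduct ρ) := by
  classical
  refine T.nonempty_starAlgEquiv_of_norm_regSum_eq π ρ fun f => le_antisymm ?_ ?_
  · exact T.norm_regSum_le_of_jointly_faithful π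
      (ρ := fun j => ρ.comp (T.α (t j) : A →⋆ₐ[ℂ] A)) hρ (norm_nonneg _)
      fun j => T.norm_regSum_comp_α_le ρ (t j) f
  · exact T.norm_regSum_le_of_jointly_faithful ρ (ρ := fun _ : Unit => π)
      (fun a ha => (injective_iff_map_eq_zero π).1 hπ a (ha ())) (norm_nonneg _) fun _ => le_rfl

end Comparison

end TwistedAction

theorem StarSubalgebra.apply_mem_of_mem_topologicalClosure {E F : Type*} [CStarAlgebra E]
    [CStarAlgebra F] {S : StarSubalgebra ℂ E} {B : Set F} (hB : IsClosed B) {f : E → F}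
    (hf : Continuous f) (h : ∀ x ∈ S, f x ∈ B) {x : E} (hx : x ∈ S.topologicalClosure) :
    f x ∈ B :=
  closure_minimal h (hB.preimage hf) hx

namespace TwistedAction

open ContinuousLinearMap

/-! ### Restriction to `ℓ²(H, K)`; its adjoint is extension by zero -/

section Restriction

variable {G K : Type*} [Group G] [NormedAddCommGroup K] [InnerProductSpace ℂ K] [CompleteSpace K]
  (H : Subgroup G)

omit [InnerProductSpace ℂ K] [CompleteSpace K] in
theorem memLp_restrict (ξ : l2 G K) : Memℓp (fun h : H => ξ h) 2 := by
  have hξ := (lp.memℓp ξ).summable (by norm_num)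
  exact memℓp_gen (hξ.comp_injective Subtype.val_injective)

variable (K) in
/-- Restriction of functions in `ℓ²(G, K)` to a subgroup. -/
def l2Restrict : l2 G K →L[ℂ] l2 H K :=
  LinearMap.mkContinuous
    { toFun := fun ξ => ⟨fun h => ξ h, memLp_restrict H ξ⟩
      map_add' := fun ξ η => by ext h; simp; rfl
      map_smul' := fun c ξ => by ext h; simp }
    1 (fun ξ => by
      have h2 : (0 : ℝ) < (2 : ℝ≥0∞).toReal := by norm_num
      refine lp.norm_le_of_forall_sum_le h2 (by positivity) (fun s => ?_)
      have hs := lp.sum_rpow_le_norm_rpow h2 ξ (s.map (Function.Embedding.subtype _))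
      rw [Finset.sum_map] at hs
      rw [one_mul]
      exact hs)

omit [CompleteSpace K] in
theorem l2Restrict_apply (ξ : l2 G K) (h : H) : l2Restrict K H ξ h = ξ h := rfl

theorem adjoint_l2Restrict_apply_coe (ξ : l2 H K) (h : H) :
    adjoint (l2Restrict K H) ξ (h : G) = ξ h := by
  classical
  rw [← adjoint_l2Single_apply h ξ, ← adjoint_l2Single_apply (h : G), ← comp_apply, ← adjoint_comp]
  congr 2
  refine clm_l2_ext fun v k => ?_
  simp only [comp_apply, l2Restrict_apply, l2Single_apply_apply, Subtype.coe_inj]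

theorem adjoint_l2Restrict_apply_of_notMem (ξ : l2 H K) {g : G} (hg : g ∉ H) :
    adjoint (l2Restrict K H) ξ g = 0 := by
  classical
  have h0 : l2Restrict K H ∘L l2Single K g = 0 := clm_l2_ext fun v k => by
    have : (k : G) ≠ g := fun e => hg (e ▸ k.2)
    simp [l2Restrict_apply, l2Single_apply_apply, this]
  rw [← adjoint_l2Single_apply g, ← comp_apply, ← adjoint_comp, h0]
  simp

theorem l2Restrict_comp_adjoint : l2Restrict K H ∘L adjoint (l2Restrict K H) = .id ℂ (l2 H K) :=
  clm_l2_ext fun ξ h => adjoint_l2Restrict_apply_coe H ξ h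

end Restriction

/-! ### The crossed product by `H` as a corner, and matrix units -/

section Corner

variable {ι : Type*} [Fintype ι] [DecidableEq ι] {A : ι → Type*} [∀ i, CStarAlgebra (A i)]
  {G : Type*} [Group G] (T : TwistedAction G (Π i, A i)) (i₀ : ι)
  {K : Type*} [NormedAddCommGroup K] [InnerProductSpace ℂ K] [CompleteSpace K]
  (π : A i₀ →⋆ₐ[ℂ] (K →L[ℂ] K))

/-- A representation of one summand, extended to the direct sum by `0`. -/
abbrev summandRep : (Π i, A i) →⋆ₐ[ℂ] (K →L[ℂ] K) := π.comp (Pi.evalStarAlgHom ℂ A i₀)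

theorem restrict_α_apply (h : T.summandStabilizer i₀) (b : Π i, A i) :
    (T.restrict i₀).α h (b i₀) = T.α h b i₀ := by
  have e : (Pi.single i₀ (b i₀) : Π i, A i) = b * summandProj A i₀ := by
    ext j
    by_cases hj : j = i₀
    · subst hj; simp [summandProj]
    · simp [summandProj, hj]
  have hh : T.α h (summandProj A i₀) = summandProj A i₀ := h.2
  change T.α h (Pi.single i₀ (b i₀)) i₀ = _
  rw [e, map_mul, hh]
  simp [summandProj]

local notation "R" => l2Restrict K (T.summandStabilizer i₀)

theorem compress_regA (b : Π i, A i) :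
    R ∘L T.regA (summandRep i₀ π) b ∘L adjoint R = (T.restrict i₀).regA π (b i₀) :=
  clm_l2_ext fun ξ h => by
    rw [comp_apply, comp_apply, l2Restrict_apply, regA_apply, regA_apply, restrict_α_apply,
      adjoint_l2Restrict_apply_coe]
    rfl

theorem compress_regU (g : T.summandStabilizer i₀) :
    R ∘L T.regU (summandRep i₀ π) g ∘L adjoint R = (T.restrict i₀).regU π g :=
  clm_l2_ext fun ξ h => by
    rw [comp_apply, comp_apply, l2Restrict_apply, regU_apply, regU_apply,
      ← adjoint_l2Restrict_apply_coe]
    rfl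

/-- `u g` moves functions supported on `H` to the coset `g H`, which is disjoint from `H`. -/
theorem compress_regU_of_notMem {g : G} (hg : g ∉ T.summandStabilizer i₀) :
    R ∘L T.regU (summandRep i₀ π) g ∘L adjoint R = 0 :=
  clm_l2_ext fun ξ h => by
    have : g⁻¹ * (h : G) ∉ T.summandStabilizer i₀ := fun e =>
      hg (inv_mem_iff.1 ((Subgroup.mul_mem_cancel_right _ h.2).1 e))
    rw [comp_apply, comp_apply, l2Restrict_apply, regU_apply,
      adjoint_l2Restrict_apply_of_notMem _ _ this, map_zero]
    rfl

variable (hT : ∀ g i, ∃ j, T.α g (summandProj A i) = summandProj A j)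
include hT

/-- In the coordinate `h` the projection acts through `α h⁻¹` of it: for `h` in the stabilizer it is
unchanged and acts as `1`, otherwise it becomes another `p j`, which the representation kills. -/
theorem adjoint_l2Restrict_comp :
    adjoint R ∘L R = T.regA (summandRep i₀ π) (summandProj A i₀) :=
  clm_l2_ext fun ξ h => by
    rw [comp_apply, regA_apply]
    by_cases hh : h ∈ T.summandStabilizer i₀
    · have h' : T.α h⁻¹ (summandProj A i₀) = summandProj A i₀ := inv_mem hh
      have : (summandRep i₀ π) (summandProj A i₀) = 1 := by simp [summandProj]
      rw [h', this]
      exact adjoint_l2Restrict_apply_coe _ _ ⟨h, hh⟩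
    · rw [adjoint_l2Restrict_apply_of_notMem _ _ hh]
      obtain ⟨j, hj⟩ := hT h⁻¹ i₀
      have hji : i₀ ≠ j := fun e => by
        subst e
        exact hh (inv_mem_iff.1 hj)
      have : (summandRep i₀ π) (summandProj A j) = 0 := by simp [summandProj, hji]
      rw [hj, this]
      rfl

theorem compress_regA_mul_regU_mem (b : Π i, A i) (g : G) :
    R ∘L (T.regA (summandRep i₀ π) b * T.regU (summandRep i₀ π) g) ∘L adjoint R ∈
      (T.restrict i₀).ReducedCrossedProduct π := by
  -- Compression is not multiplicative in general; it is here because `p i₀` is central in the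
  -- direct sum and so commutes with the left factor.
  have hcomm : T.regA (summandRep i₀ π) b * (adjoint R ∘L R) =
      (adjoint R ∘L R) * T.regA (summandRep i₀ π) b := by
    rw [adjoint_l2Restrict_comp T i₀ π hT, ← regA_mul, ← regA_mul,
      Semigroup.mem_center_iff.1 (summandProj_mem_center A i₀) b]
  have key : R ∘L (T.regA (summandRep i₀ π) b * T.regU (summandRep i₀ π) g) ∘L adjoint R =
      (R ∘L T.regA (summandRep i₀ π) b ∘L adjoint R) *
        (R ∘L T.regU (summandRep i₀ π) g ∘L adjoint R) := by
    calc _ = (R ∘L adjoint R) ∘L R ∘L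
            (T.regA (summandRep i₀ π) b * T.regU (summandRep i₀ π) g) ∘L adjoint R := by
          rw [l2Restrict_comp_adjoint, id_comp]
      _ = R ∘L ((adjoint R ∘L R) * T.regA (summandRep i₀ π) b) ∘L
            T.regU (summandRep i₀ π) g ∘L adjoint R := rfl
      _ = _ := by rw [← hcomm]; rfl
  rw [key, compress_regA]
  refine mul_mem (StarSubalgebra.le_topologicalClosure _
    (StarAlgebra.subset_adjoin _ _ (Or.inl ⟨_, rfl⟩))) ?_
  by_cases hg : g ∈ T.summandStabilizer i₀
  · rw [compress_regU T i₀ π ⟨g, hg⟩]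
    exact StarSubalgebra.le_topologicalClosure _ (StarAlgebra.subset_adjoin _ _ (Or.inr ⟨_, rfl⟩))
  · rw [compress_regU_of_notMem T i₀ π hg]
    exact zero_mem _

omit [DecidableEq ι] hT in
theorem regA_mem (ρ : (Π i, A i) →⋆ₐ[ℂ] (K →L[ℂ] K)) (a : Π i, A i) :
    T.regA ρ a ∈ T.ReducedCrossedProduct ρ :=
  StarSubalgebra.le_topologicalClosure _ (StarAlgebra.subset_adjoin _ _ (Or.inl ⟨_, rfl⟩))

omit [DecidableEq ι] hT in
theorem regU_mem (ρ : (Π i, A i) →⋆ₐ[ℂ] (K →L[ℂ] K)) (g : G) :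
    T.regU ρ g ∈ T.ReducedCrossedProduct ρ :=
  StarSubalgebra.le_topologicalClosure _ (StarAlgebra.subset_adjoin _ _ (Or.inr ⟨_, rfl⟩))

/-- Extension by zero is a continuous `*`-homomorphism with unit sent to `p i₀`, and it sends each
generator to some `p i₀ * x * p i₀` with `x` a generator upstairs. -/
theorem extend_mem {M : l2 (T.summandStabilizer i₀) K →L[ℂ] l2 (T.summandStabilizer i₀) K}
    (hM : M ∈ (T.restrict i₀).ReducedCrossedProduct π) :
    adjoint R ∘L M ∘L R ∈ T.ReducedCrossedProduct (summandRep i₀ π) := by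
  have hp := adjoint_l2Restrict_comp T i₀ π hT
  have hcont : Continuous fun M : l2 (T.summandStabilizer i₀) K →L[ℂ] l2 (T.summandStabilizer i₀) K
      => adjoint R ∘L M ∘L R :=
    continuous_const.clm_comp (continuous_id.clm_comp continuous_const)
  refine StarSubalgebra.apply_mem_of_mem_topologicalClosure
    (StarSubalgebra.isClosed_topologicalClosure _) hcont (fun M hM => ?_) hM
  have hpm := T.regA_mem (summandRep i₀ π) (summandProj A i₀)
  change adjoint R ∘L M ∘L R ∈ T.ReducedCrossedProduct (summandRep i₀ π)
  induction hM using StarAlgebra.adjoin_induction with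
  | mem x hx =>
    rcases hx with ⟨a, rfl⟩ | ⟨g, rfl⟩
    · have ha : a = (Pi.single i₀ a : Π i, A i) i₀ := by simp
      rw [ha, ← compress_regA]
      change (adjoint R ∘L R) * T.regA (summandRep i₀ π) _ * (adjoint R ∘L R) ∈ _
      rw [hp]
      exact mul_mem (mul_mem hpm (regA_mem _ _ _)) hpm
    · rw [← compress_regU]
      change (adjoint R ∘L R) * T.regU (summandRep i₀ π) _ * (adjoint R ∘L R) ∈ _
      rw [hp]
      exact mul_mem (mul_mem hpm (regU_mem _ _ _)) hpm
  | algebraMap c =>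
    have : adjoint R ∘L (algebraMap ℂ _ c) ∘L R = c • (adjoint R ∘L R) := by
      ext1 ξ; simp [Algebra.algebraMap_eq_smul_one]
    rw [this, hp]
    exact SMulMemClass.smul_mem c hpm
  | add x y _ _ h₁ h₂ =>
    rw [add_comp, comp_add]
    exact add_mem h₁ h₂
  | mul x y _ _ h₁ h₂ =>
    have : adjoint R ∘L (x * y) ∘L R = (adjoint R ∘L x ∘L R) * (adjoint R ∘L y ∘L R) := by
      change _ = adjoint R ∘L x ∘L (R ∘L adjoint R) ∘L y ∘L R
      rw [l2Restrict_comp_adjoint, id_comp]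
      rfl
    rw [this]
    exact mul_mem h₁ h₂
  | star x _ h =>
    have : adjoint R ∘L (star x) ∘L R = star (adjoint R ∘L x ∘L R) := by
      rw [star_eq_adjoint, star_eq_adjoint, adjoint_comp, adjoint_comp, adjoint_adjoint]
      rfl
    rw [this]
    exact star_mem h

variable {g : ι → G} (hg : ∀ i, T.α (g i) (summandProj A i₀) = summandProj A i)

/-- The isometry of `ℓ²(H, K)` onto the part of `ℓ²(G, K)` supported on the coset `g H`. -/
def cosetIsometry {ι : Type*} [Fintype ι] [DecidableEq ι] {A : ι → Type*}
    [∀ i, CStarAlgebra (A i)] {G : Type*} [Group G] (T : TwistedAction G (Π i, A i)) (i₀ : ι)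
    {K : Type*} [NormedAddCommGroup K] [InnerProductSpace ℂ K] [CompleteSpace K]
    (π : A i₀ →⋆ₐ[ℂ] (K →L[ℂ] K)) (g : G) : l2 (T.summandStabilizer i₀) K →L[ℂ] l2 G K :=
  T.regU (summandRep i₀ π) g ∘L adjoint (l2Restrict K (T.summandStabilizer i₀))

local notation "W" => cosetIsometry T i₀ π

omit hT in
theorem adjoint_cosetIsometry (s : G) :
    adjoint (W s) = R ∘L star (T.regU (summandRep i₀ π) s) := by
  rw [cosetIsometry, adjoint_comp, adjoint_adjoint, star_eq_adjoint]

omit hT in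
theorem adjoint_cosetIsometry_comp_self (s : G) : adjoint (W s) ∘L W s = .id ℂ _ := by
  have h := T.star_regU_mul_regU (summandRep i₀ π) s
  rw [adjoint_cosetIsometry]
  calc _ = R ∘L (star (T.regU (summandRep i₀ π) s) * T.regU (summandRep i₀ π) s) ∘L adjoint R :=
        rfl
    _ = _ := by rw [h, one_def, id_comp, l2Restrict_comp_adjoint]

include hg

theorem cosetIsometry_comp_adjoint (i : ι) :
    W (g i) ∘L adjoint (W (g i)) = T.regA (summandRep i₀ π) (summandProj A i) := by
  rw [adjoint_cosetIsometry]
  calc _ = T.regU (summandRep i₀ π) (g i) * (adjoint R ∘L R) *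
          star (T.regU (summandRep i₀ π) (g i)) := rfl
    _ = _ := by rw [adjoint_l2Restrict_comp T i₀ π hT, regU_mul_regA_mul_star_regU, hg]

/-- The ranges are those of `p i` and `p j`, which are orthogonal for `i ≠ j`. -/
theorem adjoint_cosetIsometry_comp (i j : ι) :
    adjoint (W (g i)) ∘L W (g j) = if i = j then .id ℂ _ else 0 := by
  split_ifs with h
  · rw [h, adjoint_cosetIsometry_comp_self]
  · calc _ = (adjoint (W (g i)) ∘L W (g i)) ∘L (adjoint (W (g i)) ∘L W (g j)) ∘L
          (adjoint (W (g j)) ∘L W (g j)) := by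
          simp only [adjoint_cosetIsometry_comp_self, id_comp, comp_id]
      _ = adjoint (W (g i)) ∘L ((W (g i) ∘L adjoint (W (g i))) *
          (W (g j) ∘L adjoint (W (g j)))) ∘L W (g j) := rfl
      _ = 0 := by
        have hp : summandProj A i * summandProj A j = 0 := by
          ext k
          by_cases hk : k = i
          · subst hk; simp [summandProj, h]
          · simp [summandProj, hk]
        rw [cosetIsometry_comp_adjoint T i₀ π hT hg, cosetIsometry_comp_adjoint T i₀ π hT hg,
          ← regA_mul, hp, ← regAHom_apply, map_zero]
        simp

theorem sum_cosetIsometry_comp_adjoint : ∑ i, W (g i) ∘L adjoint (W (g i)) = 1 := by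
  have hp : ∑ i, summandProj A i = 1 := Finset.univ_sum_single 1
  simp_rw [cosetIsometry_comp_adjoint T i₀ π hT hg, ← regAHom_apply]
  rw [← map_sum, hp, map_one]

theorem adjoint_cosetIsometry_comp_comp_mem {x : l2 G K →L[ℂ] l2 G K}
    (hx : x ∈ T.ReducedCrossedProduct (summandRep i₀ π)) (i j : ι) :
    adjoint (W (g i)) ∘L x ∘L W (g j) ∈ (T.restrict i₀).ReducedCrossedProduct π := by
  have hcont : Continuous fun x : l2 G K →L[ℂ] l2 G K => adjoint (W (g i)) ∘L x ∘L W (g j) :=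
    continuous_const.clm_comp (continuous_id.clm_comp continuous_const)
  refine StarSubalgebra.apply_mem_of_mem_topologicalClosure
    (StarSubalgebra.isClosed_topologicalClosure _) hcont (fun x hx => ?_) hx
  change adjoint (W (g i)) ∘L x ∘L W (g j) ∈ (T.restrict i₀).ReducedCrossedProduct π
  have hA : ∀ (b : Π i, A i) (s t : G),
      R ∘L (star (T.regU (summandRep i₀ π) s) * T.regA (summandRep i₀ π) b *
        T.regU (summandRep i₀ π) t) ∘L adjoint R ∈ (T.restrict i₀).ReducedCrossedProduct π := by
    intro b s t
    rw [star_regU_mul_regA_mul_regU]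
    exact compress_regA_mul_regU_mem T i₀ π hT _ _
  clear hcont
  induction hx using StarAlgebra.adjoin_induction generalizing i j with
  | mem x hx =>
    rw [adjoint_cosetIsometry]
    rcases hx with ⟨a, rfl⟩ | ⟨s, rfl⟩
    · exact hA a (g i) (g j)
    -- `u s * u (g j) = ω s (g j) * u (s * g j)` brings this generator to the form treated in `hA`.
    · have := hA (T.ω s (g j)) (g i) (s * g j)
      rw [mul_assoc, ← regU_mul_regU] at this
      exact this
  | algebraMap c =>
    have : adjoint (W (g i)) ∘L (algebraMap ℂ _ c) ∘L W (g j) =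
        c • (adjoint (W (g i)) ∘L W (g j)) := by
      ext1 ξ; simp [Algebra.algebraMap_eq_smul_one]
    rw [this, adjoint_cosetIsometry_comp T i₀ π hT hg]
    split_ifs
    · exact SMulMemClass.smul_mem c (one_mem _)
    · rw [smul_zero]; exact zero_mem _
  | add x y _ _ h₁ h₂ =>
    rw [add_comp, comp_add]
    exact add_mem (h₁ i j) (h₂ i j)
  | mul x y _ _ h₁ h₂ =>
    -- Inserting `1 = ∑ Wₖ Wₖ⋆` between `x` and `y` turns the product into matrix multiplication;
    -- hence the induction over all `i, j` at once.
    have : adjoint (W (g i)) ∘L (x * y) ∘L W (g j) =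
        ∑ k, (adjoint (W (g i)) ∘L x ∘L W (g k)) * (adjoint (W (g k)) ∘L y ∘L W (g j)) := by
      calc _ = adjoint (W (g i)) ∘L (x * 1 * y) ∘L W (g j) := by rw [mul_one]
        _ = _ := by
          rw [← sum_cosetIsometry_comp_adjoint T i₀ π hT hg, Finset.mul_sum, Finset.sum_mul,
            finsetSum_comp, comp_finsetSum]
          rfl
    rw [this]
    exact sum_mem fun k _ => mul_mem (h₁ i k) (h₂ k j)
  | star x _ h =>
    have : adjoint (W (g i)) ∘L (star x) ∘L W (g j) =
        star (adjoint (W (g j)) ∘L x ∘L W (g i)) := by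
      rw [star_eq_adjoint, star_eq_adjoint, adjoint_comp, adjoint_comp, adjoint_adjoint]
      rfl
    rw [this]
    exact star_mem (h j i)

theorem nonempty_starAlgEquiv_cstarMatrix :
    Nonempty (T.ReducedCrossedProduct (summandRep i₀ π) ≃⋆ₐ[ℂ]
      CStarMatrix ι ι ((T.restrict i₀).ReducedCrossedProduct π)) := by
  have hW := adjoint_cosetIsometry_comp T i₀ π hT hg
  let Ψ := matrixAmplification (fun i => W (g i)) hW
    ((T.restrict i₀).ReducedCrossedProduct π).subtype
  have hΨ : Function.Injective Ψ := matrixAmplification_injective _ hW Subtype.val_injective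
  have hmem : ∀ X, Ψ X ∈ T.ReducedCrossedProduct (summandRep i₀ π) := fun X =>
    sum_mem fun i _ => sum_mem fun j _ => by
      rw [adjoint_cosetIsometry]
      exact mul_mem (mul_mem (regU_mem T _ (g i)) (extend_mem T i₀ π hT (X i j).2))
        (star_mem (regU_mem T _ (g j)))
  let Φ : CStarMatrix ι ι ((T.restrict i₀).ReducedCrossedProduct π) →⋆ₙₐ[ℂ]
      T.ReducedCrossedProduct (summandRep i₀ π) :=
    { toFun := fun X => ⟨Ψ X, hmem X⟩
      map_smul' := fun c X => Subtype.ext (map_smul Ψ c X)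
      map_zero' := Subtype.ext (map_zero Ψ)
      map_add' := fun X Y => Subtype.ext (map_add Ψ X Y)
      map_mul' := fun X Y => Subtype.ext (map_mul Ψ X Y)
      map_star' := fun X => Subtype.ext (map_star Ψ X) }
  refine ⟨(StarAlgEquiv.ofBijective Φ ⟨fun X Y h => hΨ (congrArg Subtype.val h), ?_⟩).symm⟩
  rintro ⟨x, hx⟩
  refine ⟨CStarMatrix.ofMatrix (Matrix.of fun i j => ⟨adjoint (W (g i)) ∘L x ∘L W (g j),
    adjoint_cosetIsometry_comp_comp_mem T i₀ π hT hg hx i j⟩), Subtype.ext ?_⟩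
  change ∑ i, ∑ j, W (g i) ∘L (adjoint (W (g i)) ∘L x ∘L W (g j)) ∘L adjoint (W (g j)) = x
  calc _ = (∑ i, W (g i) ∘L adjoint (W (g i))) * x * ∑ j, W (g j) ∘L adjoint (W (g j)) := by
        rw [Finset.sum_mul, Finset.sum_mul_sum]
        rfl
    _ = x := by rw [sum_cosetIsometry_comp_adjoint T i₀ π hT hg, one_mul, mul_one]

end Corner

end TwistedAction

/-! ### Minimal central projections and the action on them -/

section MinimalCentralProjections

variable {ι : Type*} [DecidableEq ι] {A : ι → Type*} [∀ i, CStarAlgebra (A i)]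

theorem summandProj_ne_zero [Fintype ι] (i : ι) [Nontrivial (A i)] : summandProj A i ≠ 0 :=
  fun h => by simpa [summandProj] using congrFun h i

theorem isStarProjection_summandProj [Fintype ι] (i : ι) :
    IsStarProjection (summandProj A i) := by
  refine ⟨?_, ?_⟩
  · change summandProj A i * summandProj A i = summandProj A i
    rw [summandProj, ← Pi.single_mul, mul_one]
  · change star (summandProj A i) = summandProj A i
    rw [summandProj, ← Pi.single_star, star_one]

theorem apply_mem_center {q : Π i, A i} (hq : q ∈ Set.center (Π i, A i)) (i : ι) :
    q i ∈ Set.center (A i) := by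
  rw [Semigroup.mem_center_iff] at hq ⊢
  intro a
  simpa using congrFun (hq (Pi.single i a)) i

omit [DecidableEq ι] in
theorem IsStarProjection.apply {q : Π i, A i} (hq : IsStarProjection q) (i : ι) :
    IsStarProjection (q i) :=
  ⟨congrFun hq.1 i, congrFun hq.2 i⟩

theorem setOf_isMinimalCentralProjection [Fintype ι] [∀ i, Nontrivial (A i)]
    (hA : ∀ (i : ι) (q : A i), IsStarProjection q → q ∈ Set.center (A i) → q = 0 ∨ q = 1) :
    {q : Π i, A i | IsMinimalCentralProjection q} = Set.range (summandProj A) := by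
  ext q
  constructor
  · rintro ⟨hp, hc, h0, hmin⟩
    obtain ⟨i, hi⟩ := Function.ne_iff.1 h0
    have hi1 : q i = 1 := (hA i _ (hp.apply i) (apply_mem_center hc i)).resolve_left hi
    have hle : summandProj A i * q = summandProj A i := by
      ext j
      by_cases hj : j = i
      · subst hj; simp [summandProj, hi1]
      · simp [summandProj, hj]
    exact ⟨i, (hmin _ (isStarProjection_summandProj i) (summandProj_mem_center A i) hle).resolve_left
      (summandProj_ne_zero i)⟩
  · rintro ⟨i, rfl⟩
    refine ⟨isStarProjection_summandProj i, summandProj_mem_center A i, summandProj_ne_zero i,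
      fun r hr hc hle => ?_⟩
    rw [← eq_single_of_mul_summandProj hle]
    rcases hA i _ (hr.apply i) (apply_mem_center hc i) with h | h
    · left; rw [h, Pi.single_zero]
    · right; rw [h]; rfl

end MinimalCentralProjections

theorem StarAlgEquiv.apply_mem_center {A B : Type*} [CStarAlgebra A] [CStarAlgebra B]
    (φ : A ≃⋆ₐ[ℂ] B) {q : A} (hq : q ∈ Set.center A) : φ q ∈ Set.center B := by
  rw [Semigroup.mem_center_iff] at hq ⊢
  intro b
  obtain ⟨a, rfl⟩ := EquivLike.surjective φ b
  rw [← map_mul, hq, map_mul]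

theorem IsMinimalCentralProjection.map {A B : Type*} [CStarAlgebra A] [CStarAlgebra B]
    (φ : A ≃⋆ₐ[ℂ] B) {q : A} (hq : IsMinimalCentralProjection q) :
    IsMinimalCentralProjection (φ q) := by
  obtain ⟨hp, hc, h0, hmin⟩ := hq
  refine ⟨hp.map φ, φ.apply_mem_center hc, fun h => h0 (EquivLike.injective φ (by rw [h, map_zero])),
    fun r hr hrc hle => ?_⟩
  have := hmin (φ.symm r) (hr.map φ.symm) (φ.symm.apply_mem_center hrc)
    (EquivLike.injective φ (by simpa using hle))
  rcases this with h | h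
  · left; simpa using congrArg φ h
  · right; simpa using congrArg φ h

/-- Conjugation by `ω s t` is trivial on the center, so the twist disappears there. -/
theorem TwistedAction.α_mul_of_mem_center {G : Type*} [Group G] {A : Type*} [CStarAlgebra A]
    (T : TwistedAction G A) (s t : G) {q : A} (hq : q ∈ Set.center A) :
    T.α (s * t) q = T.α s (T.α t q) := by
  have h := (T.α (s * t)).apply_mem_center hq
  rw [T.α_comp, Semigroup.mem_center_iff.1 h, mul_assoc,
    Unitary.mul_star_self_of_mem (T.ω s t).2, mul_one]

end

theorem mainTheorem9 {n : ℕ} [NeZero n]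
    (A : Fin n → Type*) [∀ i, CStarAlgebra (A i)] [∀ i, Nontrivial (A i)]
    (hA : ∀ (i : Fin n) (q : A i), IsStarProjection q → q ∈ Set.center (A i) → q = 0 ∨ q = 1)
    {G : Type*} [Group G] (T : TwistedAction G (Π i, A i)) :
    {q : Π i, A i | IsMinimalCentralProjection q} = Set.range (summandProj A) ∧
    ∃ _act : MulAction G (Set.range (summandProj A)),
      (∀ (g : G) (q : Set.range (summandProj A)),
        ((g • q : Set.range (summandProj A)) : Π i, A i) = T.α g q) ∧
      (MulAction.IsPretransitive G (Set.range (summandProj A)) →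
        ∀ (K : Type*) [NormedAddCommGroup K] [InnerProductSpace ℂ K] [CompleteSpace K]
          (π : (Π i, A i) →⋆ₐ[ℂ] (K →L[ℂ] K)), Function.Injective π →
        ∀ (K₁ : Type*) [NormedAddCommGroup K₁] [InnerProductSpace ℂ K₁] [CompleteSpace K₁]
          (π₁ : A 0 →⋆ₐ[ℂ] (K₁ →L[ℂ] K₁)), Function.Injective π₁ →
        Nonempty (T.ReducedCrossedProduct π ≃⋆ₐ[ℂ]
          CStarMatrix (Fin n) (Fin n) ((T.restrict 0).ReducedCrossedProduct π₁))) := by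
  have hmin := setOf_isMinimalCentralProjection hA
  have hmem : ∀ (g : G) (q : Set.range (summandProj A)), T.α g q ∈ Set.range (summandProj A) := by
    intro g q
    exact hmin.subset (IsMinimalCentralProjection.map (T.α g) (hmin.superset q.2))
  have hcenter : ∀ q : Set.range (summandProj A), (q : Π i, A i) ∈ Set.center (Π i, A i) := by
    rintro ⟨_, i, rfl⟩
    exact summandProj_mem_center A i
  refine ⟨hmin,
    { smul := fun g q => ⟨T.α g q, hmem g q⟩
      one_smul := fun q => Subtype.ext (T.α_one q)
      mul_smul := fun s t q => Subtype.ext (T.α_mul_of_mem_center s t (hcenter q)) },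
    fun g q => rfl, fun htrans K _ _ _ π hπ K₁ _ _ _ π₁ hπ₁ => ?_⟩
  have hT : ∀ g i, ∃ j, T.α g (summandProj A i) = summandProj A j := fun g i => by
    obtain ⟨j, hj⟩ := hmem g ⟨_, i, rfl⟩
    exact ⟨j, hj.symm⟩
  have htr : ∀ i j, ∃ g, T.α g (summandProj A i) = summandProj A j := fun i j => by
    obtain ⟨g, hg⟩ := htrans.exists_smul_eq ⟨_, i, rfl⟩ ⟨_, j, rfl⟩
    exact ⟨g, congrArg Subtype.val hg⟩
  choose g hg using htr 0
  choose t ht using fun j => htr j 0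
  -- Since `α (t j)` carries `p j` to `p 0`, the translate of `π₁ ∘ ev₀` by `t j` is faithful on the
  -- summand `A j`; together the translates detect every component.
  obtain ⟨e₁⟩ := T.nonempty_starAlgEquiv_of_translates_jointly_faithful π
    (TwistedAction.summandRep 0 π₁) hπ t fun a ha => by
      ext j
      have h0 : T.α (t j) a 0 = 0 := (injective_iff_map_eq_zero π₁).1 hπ₁ _ (ha j)
      have h1 : T.α (t j) (a * summandProj A j) = 0 := by
        rw [map_mul, ht]
        ext k
        by_cases hk : k = 0
        · subst hk; simp [h0]
        · simp [summandProj, hk]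
      have h2 := congrFun ((map_eq_zero_iff _ (EquivLike.injective (T.α (t j)))).1 h1) j
      simpa [summandProj] using h2
  obtain ⟨e₂⟩ := T.nonempty_starAlgEquiv_cstarMatrix 0 π₁ hT hg
  exact ⟨e₁.trans e₂⟩
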